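/- For an integer $k\ge 3$, a loose cycle $C_k$ is a hypergraph with distinct edges $e_1,\dots,e_k$ and distinct vertices $v_1,\dots,v_k$ such that $e_i\cap e_{i+1}=\{v_i\}$ for $1\le i\le k-1$, $e_k\cap e_1=\{v_k\}$, and $e_i\cap e_j=\emptyset$ for all other pairs $i\ne j$. Let $[n]=\{1,\dots,n\}$. An edge-coloring of a graph $G$ with $V(G)\subset[n]$ is a family $(z_e)_{e\in G}$ with $z_e\in[n]\setminus e$ for every edge $e$ of $G$; its set of colors is $\{z_e: e\in G\}$, and its extension is the $3$-uniform hypergraph $G^*=\{e\cup\{z_e\}: e\in G\}$. For each integer $l\ge 2$ there is a constant $D=D_l>0$ such that the following holds. Let $n$ be a natural number, let $s,t\ge 1$, let $G=K_{s,t}$ be a complete bipartite graph with $V(G)\subset[n]$, and let $Z\subset[n]$. Then the number of edge-colorings of $G$ whose set of colors is exactly $Z$ and whose extension $G^*$ contains no $C_{2l}$ (as a not necessarily induced subhypergraph) is at most $D^{(s+t)^2}$. -/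

import Mathlib

/-- A hypergraph on the vertex type `V`, given by its (finite) set of edges. -/
abbrev FinHypergraph (V : Type*) := Finset (Finset V)

/-- The edges `e 0, …, e (k-1)` and the vertices `v 0, …, v (k-1)` form a loose (linear) `k`-cycle:
the edges are distinct, the vertices are distinct, cyclically consecutive edges `e i`, `e (i+1)`
meet exactly in `v i`, and all other pairs of edges are disjoint. -/
structure IsLooseCycle {V : Type*} [DecidableEq V] (k : ℕ)
    (e : Fin k → Finset V) (v : Fin k → V) : Prop where
  edge_injective : Function.Injective e
  vertex_injective : Function.Injective v
  inter_consecutive : ∀ i j : Fin k, (j : ℕ) = ((i : ℕ) + 1) % k → e i ∩ e j = {v i}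
  disjoint_other : ∀ i j : Fin k, i ≠ j → (j : ℕ) ≠ ((i : ℕ) + 1) % k →
    (i : ℕ) ≠ ((j : ℕ) + 1) % k → Disjoint (e i) (e j)

/-- `H` contains a loose cycle `C_k` as a (not necessarily induced) subhypergraph. -/
def ContainsLooseCycle {V : Type*} [DecidableEq V] (H : FinHypergraph V) (k : ℕ) : Prop :=
  ∃ (e : Fin k → Finset V) (v : Fin k → V), (∀ i, e i ∈ H) ∧ IsLooseCycle k e v

/-- The complete bipartite graph with parts `X` and `Y` (meant for disjoint `X`, `Y`),
as a set of two-element edges. -/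
def completeBipartiteOn {V : Type*} [DecidableEq V] (X Y : Finset V) : FinHypergraph V :=
  (X ×ˢ Y).image fun p => {p.1, p.2}

/-- An edge-coloring of `G` with vertices as colors: every edge `e` receives a color `z_e ∉ e`. -/
@[ext]
structure EdgeColoring {V : Type*} (G : FinHypergraph V) where
  color : {e : Finset V // e ∈ G} → V
  color_notMem : ∀ e : {e : Finset V // e ∈ G}, color e ∉ e.1

namespace EdgeColoring

instance {V : Type*} [Finite V] (G : FinHypergraph V) : Finite (EdgeColoring G) :=
  Finite.of_injective EdgeColoring.color fun _ _ h => EdgeColoring.ext h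

variable {V : Type*} [DecidableEq V] {G : FinHypergraph V}

/-- The set `{z_e : e ∈ G}` of all colors used by the coloring. -/
def colorSet (N : EdgeColoring G) : Finset V :=
  G.attach.image N.color

/-- The extension `{e ∪ {z_e} : e ∈ G}` of `G` by the coloring. -/
def extension (N : EdgeColoring G) : FinHypergraph V :=
  G.attach.image fun e => insert (N.color e) e.1

end EdgeColoring

/-! Let M = s + t. Call an edge rare at scale R if its color occurs at most M / R times at each of
its ends. Among the homomorphisms of K_{l,l} into the rare edges, only an O(1/R) proportion of all
vertex maps can be non-injective, repeat a color, or use an image vertex as a color. By the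
Sidorenko inequality for K_{l,l}, more than C M² / R^{1/l²} rare edges would leave a good
homomorphism, and a Hamilton cycle of its image extends to a C_{2l}. So at scale R = 2^{l² j} there
are at most C M² / 2^j rare edges (`card_rareEdges_pow_le`, `card_rareEdges_mul_le`).

Give each edge as its level the first j at which it is not rare, cut off at J + 1. The levels add up
to O(M²) (`exists_level`). An edge of level j ≤ J has a color popular at one of its ends, and a
vertex has at most 2^{l² j} popular colors. Once the lists of popular colors are fixed, such an edge
has only 2^{O(j + 1)} possible colors. Beyond J all of Z is allowed, and |Z| ≤ |G| ≤ M² whatever n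
is.

With 2^{l² J} roughly a small power of M, there are 2^{O(M²)} systems of lists, as many level
functions, and 2^{O(M²)} colorings for each choice of both. -/

/-! ### Homomorphism counts and rainbow copies of K_{l,l} -/

/-- If, for a fixed coordinate `k`, every line in direction `k` meets `S` in at most a `1 / R`
proportion of its points, then `S` has density at most `1 / R`. -/
theorem mul_card_le_of_line_card_le {ι W : Type*} [Fintype ι] [DecidableEq ι] [Fintype W]
    [DecidableEq W] (S : Finset (ι → W)) (k : ι) (R : ℕ) (hR : 0 < R)
    (h : ∀ f, R * (Finset.univ.filter fun a => Function.update f k a ∈ S).card ≤ Fintype.card W) :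
    R * S.card ≤ Fintype.card W ^ Fintype.card ι := by
  -- Forgetting coordinate `k` partitions the cube into lines in direction `k`.
  obtain ⟨π, hπ⟩ : ∃ π : (ι → W) → ({j // j ≠ k} → W), ∀ f j, π f j = f j :=
    ⟨fun f j => f j, fun _ _ => rfl⟩
  have key : ∀ f g, π f = π g → f = Function.update g k (f k) := by
    intro f g hfg
    funext j
    by_cases hj : j = k
    · subst hj; simp
    · rw [Function.update_of_ne hj, ← hπ f ⟨j, hj⟩, hfg, hπ]
  have hfib : ∀ b ∈ (Finset.univ : Finset ({j // j ≠ k} → W)),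
      (S.filter fun f => π f = b).card ≤ Fintype.card W / R := by
    intro b _
    rcases (S.filter fun f => π f = b).eq_empty_or_nonempty with h0 | ⟨g, hg⟩
    · rw [h0, Finset.card_empty]; exact Nat.zero_le _
    · rw [Nat.le_div_iff_mul_le hR, mul_comm]
      refine le_trans (Nat.mul_le_mul_left R ?_) (h g)
      have hgb := (Finset.mem_filter.1 hg).2
      refine Finset.card_le_card_of_injOn (fun f => f k) ?_ ?_
      · intro f hf
        obtain ⟨hfS, hfb⟩ := Finset.mem_filter.1 (Finset.mem_coe.1 hf)
        refine Finset.mem_coe.2 (Finset.mem_filter.2 ⟨Finset.mem_univ _, ?_⟩)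
        rwa [← key f g (hfb.trans hgb.symm)]
      · intro f hf f' hf' hff
        obtain ⟨-, hfb⟩ := Finset.mem_filter.1 (Finset.mem_coe.1 hf)
        obtain ⟨-, hfb'⟩ := Finset.mem_filter.1 (Finset.mem_coe.1 hf')
        rw [key f g (hfb.trans hgb.symm), key f' g (hfb'.trans hgb.symm)]
        exact congrArg _ hff
  have hle := Finset.card_le_mul_card_image_of_maps_to (s := S)
    (f := π) (t := Finset.univ) (fun _ _ => Finset.mem_univ _) _ hfib
  have hcard : (Finset.univ : Finset ({j // j ≠ k} → W)).card
      = Fintype.card W ^ (Fintype.card ι - 1) := by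
    rw [Finset.card_univ, Fintype.card_fun, Fintype.card_subtype_compl, Fintype.card_subtype_eq]
  rw [hcard] at hle
  have hpos : 0 < Fintype.card ι := Fintype.card_pos_iff.2 ⟨k⟩
  calc R * S.card ≤ R * (Fintype.card W / R * Fintype.card W ^ (Fintype.card ι - 1)) :=
        Nat.mul_le_mul_left _ hle
    _ = (R * (Fintype.card W / R)) * Fintype.card W ^ (Fintype.card ι - 1) := by rw [mul_assoc]
    _ ≤ Fintype.card W * Fintype.card W ^ (Fintype.card ι - 1) :=
        Nat.mul_le_mul_right _ (Nat.mul_div_le _ _)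
    _ = Fintype.card W ^ Fintype.card ι := by
        rw [← pow_succ', Nat.sub_add_cancel hpos]

/-- The homomorphisms of `K_{l,l}` into a relation. -/
def bicliqueHoms {W : Type*} [Fintype W] [DecidableEq W] (r : W → W → Prop) [DecidableRel r]
    (l : ℕ) : Finset (Fin l ⊕ Fin l → W) :=
  Finset.univ.filter fun f => ∀ i j, r (f (Sum.inl i)) (f (Sum.inr j))

/-- Once the right side is mapped by `g`, the `l` left vertices choose independently among the
common neighbors of its image. -/
theorem card_bicliqueHoms_eq_sum {W : Type*} [Fintype W] [DecidableEq W] (r : W → W → Prop)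
    [DecidableRel r] (l : ℕ) :
    (bicliqueHoms r l).card
      = ∑ g : Fin l → W, (∑ x, ∏ j, if r x (g j) then 1 else 0) ^ l := by
  rw [bicliqueHoms, Finset.card_filter,
    ← (Equiv.sumArrowEquivProdArrow (Fin l) (Fin l) W).symm.sum_comp, Fintype.sum_prod_type_right]
  refine Finset.sum_congr rfl fun g _ => ?_
  rw [Fintype.sum_pow]
  refine Finset.sum_congr rfl fun f _ => ?_
  simp only [Equiv.sumArrowEquivProdArrow_symm_apply_inl,
    Equiv.sumArrowEquivProdArrow_symm_apply_inr, Finset.prod_boole, Finset.mem_univ, true_imp_iff]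
  exact if_congr Iff.rfl rfl rfl

theorem pow_sum_univ_le {ι : Type*} [Fintype ι] (f : ι → ℕ) (l : ℕ) (hl : 0 < l) :
    (∑ i, f i) ^ l ≤ Fintype.card ι ^ (l - 1) * ∑ i, f i ^ l := by
  obtain ⟨k, rfl⟩ := Nat.exists_eq_succ_of_ne_zero hl.ne'
  have := pow_sum_le_card_mul_sum_pow (s := (Finset.univ : Finset ι)) (f := fun i => (f i : ℚ))
    (fun _ _ => by positivity) k
  rw [Finset.card_univ] at this
  exact_mod_cast this

/-- Sidorenko's inequality for K_{l,l}, by two applications of the power mean inequality: to the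
degrees, then to the common neighborhoods of `l`-tuples. -/
theorem pow_card_le_card_bicliqueHoms {W : Type*} [Fintype W] [DecidableEq W] (r : W → W → Prop)
    [DecidableRel r] (l : ℕ) (hl : 0 < l) :
    (Finset.univ.filter fun p : W × W => r p.1 p.2).card ^ (l ^ 2)
      ≤ Fintype.card W ^ (2 * l * (l - 1)) * (bicliqueHoms r l).card := by
  have h1 : (Finset.univ.filter fun p : W × W => r p.1 p.2).card
      = ∑ x, ∑ y, if r x y then 1 else 0 := by
    rw [Finset.card_filter, Fintype.sum_prod_type]
  have h2 := pow_sum_univ_le (fun x => ∑ y, if r x y then 1 else 0) l hl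
  have h3 : ∑ x, (∑ y, if r x y then 1 else 0) ^ l
      = ∑ g : Fin l → W, ∑ x, ∏ j, if r x (g j) then 1 else 0 := by
    rw [Finset.sum_comm]
    exact Finset.sum_congr rfl fun x _ => Fintype.sum_pow _ _
  have h4 := pow_sum_univ_le (fun g : Fin l → W => ∑ x, ∏ j, if r x (g j) then 1 else 0) l hl
  rw [← card_bicliqueHoms_eq_sum, ← h3, Fintype.card_fun, Fintype.card_fin] at h4
  rw [h1, pow_two, pow_mul]
  refine (Nat.pow_le_pow_left h2 l).trans ?_
  rw [mul_pow]
  refine (Nat.mul_le_mul_left _ h4).trans (le_of_eq ?_)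
  ring

/-- Union bound over the bad homomorphisms: 4l² pairs of vertices may coincide, l⁴ pairs of edges
may share a color, and 2l³ edge-vertex pairs may have the color equal to the vertex. Moving a single
vertex shows that each event has density at most 1 / R, so `hbig` and Sidorenko leave a good
homomorphism. -/
theorem exists_rainbow_biclique {W κ : Type*} [Fintype W] [DecidableEq W] [DecidableEq κ]
    (φ : W → κ) (hφ : Function.Injective φ) (r : W → W → Prop) [DecidableRel r] (c : W → W → κ)
    (hc : ∀ x y, r x y → c x y ≠ φ x ∧ c x y ≠ φ y) (l R : ℕ) (hl : 0 < l) (hR : 0 < R)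
    (hRW : R ≤ Fintype.card W)
    (hrow : ∀ x z, R * (Finset.univ.filter fun y => r x y ∧ c x y = z).card ≤ Fintype.card W)
    (hcol : ∀ y z, R * (Finset.univ.filter fun x => r x y ∧ c x y = z).card ≤ Fintype.card W)
    (hbig : (4 * l ^ 2 + l ^ 4 + 2 * l ^ 3) * Fintype.card W ^ (2 * l ^ 2)
      < R * (Finset.univ.filter fun p : W × W => r p.1 p.2).card ^ (l ^ 2)) :
    ∃ f : Fin l ⊕ Fin l → W, Function.Injective f ∧
      (∀ i j, r (f (Sum.inl i)) (f (Sum.inr j))) ∧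
      (∀ p q : Fin l × Fin l, c (f (Sum.inl p.1)) (f (Sum.inr p.2))
        = c (f (Sum.inl q.1)) (f (Sum.inr q.2)) → p = q) ∧
      ∀ i j k, c (f (Sum.inl i)) (f (Sum.inr j)) ≠ φ (f k) := by
  set N := Fintype.card W with hN
  set H := bicliqueHoms r l with hH
  let col (f : Fin l ⊕ Fin l → W) (p : Fin l × Fin l) : κ :=
    c (f (Sum.inl p.1)) (f (Sum.inr p.2))
  have memH : ∀ f, f ∈ H ↔ ∀ i j, r (f (Sum.inl i)) (f (Sum.inr j)) := by
    intro f; simp [hH, bicliqueHoms]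
  let B1 (k : (Fin l ⊕ Fin l) × (Fin l ⊕ Fin l)) : Finset (Fin l ⊕ Fin l → W) :=
    H.filter fun f => k.1 ≠ k.2 ∧ f k.1 = f k.2
  let B2 (p : (Fin l × Fin l) × (Fin l × Fin l)) : Finset (Fin l ⊕ Fin l → W) :=
    H.filter fun f => p.1 ≠ p.2 ∧ col f p.1 = col f p.2
  let B3 (p : (Fin l × Fin l) × (Fin l ⊕ Fin l)) : Finset (Fin l ⊕ Fin l → W) :=
    H.filter fun f => col f p.1 = φ (f p.2)
  have hcard : Fintype.card (Fin l ⊕ Fin l) = 2 * l := by simp; ring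
  -- Where the moving vertex has at most one bad position, `R ≤ N` gives density 1 / R.
  have hone : ∀ (s : Finset W), (∀ a ∈ s, ∀ b ∈ s, a = b) → R * s.card ≤ N := by
    intro s hs
    exact (Nat.mul_le_mul_left R (Finset.card_le_one.2 hs)).trans (by simpa using hRW)
  have hB1 : ∀ k, R * (B1 k).card ≤ N ^ (2 * l) := by
    rintro ⟨k, k'⟩
    rw [← hcard]
    refine mul_card_le_of_line_card_le _ k R hR fun f => hone _ ?_
    intro a ha b hb
    simp only [B1, Finset.mem_filter, Finset.mem_univ, true_and, Function.update_self] at ha hb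
    rw [Function.update_of_ne (Ne.symm ha.2.1)] at ha hb
    exact ha.2.2.trans hb.2.2.symm
  have hB2 : ∀ p, R * (B2 p).card ≤ N ^ (2 * l) := by
    rintro ⟨p, q⟩
    rw [← hcard]
    -- Two distinct edges differ at some end. Moving that end of `q` keeps the color of `p` fixed,
    -- so the row or column bound applies.
    by_cases h2 : p.2 = q.2
    · by_cases h1 : p.1 = q.1
      · have : B2 (p, q) = ∅ := by
          ext f; simp [B2, Prod.ext h1 h2]
        rw [this]; simp
      · refine mul_card_le_of_line_card_le _ (Sum.inl q.1) R hR fun f =>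
          (Nat.mul_le_mul_left R (Finset.card_le_card ?_)).trans
            (hcol (f (Sum.inr q.2)) (col f p))
        intro a ha
        simp only [B2, Finset.mem_filter, Finset.mem_univ, true_and, memH, col] at ha ⊢
        obtain ⟨hr, -, hcc⟩ := ha
        have hr' := hr q.1 q.2
        have e1 : (Sum.inl p.1 : Fin l ⊕ Fin l) ≠ Sum.inl q.1 := by simpa using h1
        simp only [Function.update_self, Function.update_of_ne e1, ne_eq, reduceCtorEq,
          not_false_eq_true, Function.update_of_ne] at hr' hcc
        exact ⟨hr', hcc.symm⟩
    · refine mul_card_le_of_line_card_le _ (Sum.inr q.2) R hR fun f =>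
          (Nat.mul_le_mul_left R (Finset.card_le_card ?_)).trans
            (hrow (f (Sum.inl q.1)) (col f p))
      intro a ha
      simp only [B2, Finset.mem_filter, Finset.mem_univ, true_and, memH, col] at ha ⊢
      obtain ⟨hr, -, hcc⟩ := ha
      have hr' := hr q.1 q.2
      have e1 : (Sum.inr p.2 : Fin l ⊕ Fin l) ≠ Sum.inr q.2 := by simpa using h2
      simp only [Function.update_self, Function.update_of_ne e1, ne_eq, reduceCtorEq,
        not_false_eq_true, Function.update_of_ne] at hr' hcc
      exact ⟨hr', hcc.symm⟩
  have hB3 : ∀ p, R * (B3 p).card ≤ N ^ (2 * l) := by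
    rintro ⟨p, k⟩
    rw [← hcard]
    refine mul_card_le_of_line_card_le _ k R hR fun f => hone _ ?_
    intro a ha b hb
    simp only [B3, Finset.mem_filter, Finset.mem_univ, true_and, memH, col,
      Function.update_self] at ha hb
    -- If `k` is an end of `p`, the event contradicts `hc`. Otherwise the color stays fixed as `k`
    -- moves, and injectivity of `φ` leaves at most one position.
    by_cases h1 : Sum.inl p.1 = k
    · subst h1
      have := (hc _ _ (ha.1 p.1 p.2)).1
      rw [ha.2] at this
      simp at this
    by_cases h2 : Sum.inr p.2 = k
    · subst h2
      have := (hc _ _ (ha.1 p.1 p.2)).2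
      rw [ha.2] at this
      simp at this
    rw [Function.update_of_ne h1, Function.update_of_ne h2] at ha hb
    exact hφ (ha.2.symm.trans hb.2)
  by_contra hcon
  have hsub : H ⊆ (Finset.univ.biUnion B1 ∪ Finset.univ.biUnion B2) ∪ Finset.univ.biUnion B3 := by
    intro f hf
    by_contra hnot
    simp only [Finset.mem_union, Finset.mem_biUnion, Finset.mem_univ, true_and, not_or, not_exists,
      B1, B2, B3, Finset.mem_filter, hf, not_and] at hnot
    obtain ⟨⟨n1, n2⟩, n3⟩ := hnot
    refine hcon ⟨f, ?_, (memH f).1 hf, ?_, ?_⟩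
    · intro k k' hk
      by_contra hne
      exact n1 (k, k') hne hk
    · intro p q hpq
      by_contra hne
      exact n2 (p, q) hne hpq
    · intro i j k
      exact n3 ((i, j), k)
  have hunion : ∀ {I : Type} [Fintype I] [DecidableEq I] (B : I → Finset (Fin l ⊕ Fin l → W)),
      (∀ i, R * (B i).card ≤ N ^ (2 * l)) →
      R * (Finset.univ.biUnion B).card ≤ Fintype.card I * N ^ (2 * l) := by
    intro I _ _ B hB
    refine (Nat.mul_le_mul_left R Finset.card_biUnion_le).trans ?_
    rw [Finset.mul_sum]
    exact (Finset.sum_le_card_nsmul _ _ _ fun i _ => hB i).trans (by simp)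
  have hHle : R * H.card ≤ (4 * l ^ 2 + l ^ 4 + 2 * l ^ 3) * N ^ (2 * l) := by
    have u1 := hunion B1 hB1
    have u2 := hunion B2 hB2
    have u3 := hunion B3 hB3
    simp only [Fintype.card_prod, Fintype.card_sum, Fintype.card_fin] at u1 u2 u3
    calc R * H.card ≤ R * ((Finset.univ.biUnion B1).card + (Finset.univ.biUnion B2).card
          + (Finset.univ.biUnion B3).card) := by
          refine Nat.mul_le_mul_left R ((Finset.card_le_card hsub).trans ?_)
          exact (Finset.card_union_le _ _).trans
            (Nat.add_le_add_right (Finset.card_union_le _ _) _)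
      _ = _ := by rw [mul_add, mul_add]
      _ ≤ _ := add_le_add (add_le_add u1 u2) u3
      _ = _ := by ring
  have hhom := pow_card_le_card_bicliqueHoms r l hl
  rw [← hN, ← hH] at hhom
  have hexp : 2 * l ^ 2 = 2 * l * (l - 1) + 2 * l := by
    obtain ⟨k, rfl⟩ := Nat.exists_eq_succ_of_ne_zero hl.ne'
    simp only [Nat.succ_eq_add_one, Nat.add_sub_cancel]; ring
  refine absurd hbig (not_lt.2 ?_)
  calc _ ≤ R * (N ^ (2 * l * (l - 1)) * H.card) := Nat.mul_le_mul_left R hhom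
    _ = N ^ (2 * l * (l - 1)) * (R * H.card) := by ring
    _ ≤ N ^ (2 * l * (l - 1)) * ((4 * l ^ 2 + l ^ 4 + 2 * l ^ 3) * N ^ (2 * l)) :=
        Nat.mul_le_mul_left _ hHle
    _ = _ := by rw [hexp, pow_add]; ring

/-! ### Loose cycles from rainbow bicliques -/

theorem isLooseCycle_of_injective {V : Type*} [DecidableEq V] {k : ℕ} (hk : 3 ≤ k)
    (w d : Fin k → V) (hw : Function.Injective w) (hd : Function.Injective d)
    (hwd : ∀ i j, d i ≠ w j) (nx : Fin k → Fin k) (hnx : ∀ i, (nx i : ℕ) = ((i : ℕ) + 1) % k) :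
    IsLooseCycle k (fun i => insert (d i) {w i, w (nx i)}) (fun i => w (nx i)) := by
  have hval : ∀ i : Fin k, ((nx i : ℕ) = i + 1 ∧ (i : ℕ) + 1 < k) ∨
      ((nx i : ℕ) = 0 ∧ (i : ℕ) + 1 = k) := by
    intro i
    rw [hnx]
    rcases Nat.lt_or_ge ((i : ℕ) + 1) k with h | h
    · exact Or.inl ⟨Nat.mod_eq_of_lt h, h⟩
    · have : (i : ℕ) + 1 = k := by omega
      exact Or.inr ⟨by rw [this, Nat.mod_self], this⟩
  have hinj : Function.Injective nx := by
    intro i j hij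
    have := congrArg Fin.val hij
    have h1 := hval i
    have h2 := hval j
    ext; omega
  have hne : ∀ i, nx i ≠ i := by
    intro i hi
    have := congrArg Fin.val hi
    have h1 := hval i
    omega
  -- This is where `3 ≤ k` is needed.
  have hne2 : ∀ i, nx (nx i) ≠ i := by
    intro i hi
    have := congrArg Fin.val hi
    have h1 := hval i
    have h2 := hval (nx i)
    omega
  refine ⟨?_, hw.comp hinj, ?_, ?_⟩
  · intro i j hij
    have : d i ∈ insert (d j) ({w j, w (nx j)} : Finset V) := by
      have hij' : insert (d i) ({w i, w (nx i)} : Finset V) = insert (d j) {w j, w (nx j)} := hij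
      rw [← hij']; exact Finset.mem_insert_self _ _
    simp only [Finset.mem_insert, Finset.mem_singleton, hwd, or_false] at this
    exact hd this
  · intro i j hij
    obtain rfl : j = nx i := Fin.ext (hij.trans (hnx i).symm)
    ext a
    simp only [Finset.mem_inter, Finset.mem_insert, Finset.mem_singleton]
    constructor
    · rintro ⟨rfl | rfl | rfl, h⟩
      · simp only [hwd, or_false, hd.eq_iff] at h
        exact absurd h.symm (hne i)
      · simp only [(hwd _ _).symm, false_or, hw.eq_iff] at h
        rcases h with h | h
        · exact absurd h.symm (hne i)
        · exact absurd h.symm (hne2 i)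
      · rfl
    · rintro rfl
      exact ⟨Or.inr (Or.inr rfl), Or.inr (Or.inl rfl)⟩
  · intro i j hij h1 h2
    have n1 : j ≠ nx i := fun h => h1 (by rw [h, hnx])
    have n2 : i ≠ nx j := fun h => h2 (by rw [h, hnx])
    rw [Finset.disjoint_left]
    intro a ha hb
    simp only [Finset.mem_insert, Finset.mem_singleton] at ha hb
    rcases ha with rfl | rfl | rfl
    · simp only [hwd, or_false, hd.eq_iff] at hb
      exact hij hb
    · simp only [(hwd _ _).symm, false_or, hw.eq_iff] at hb
      exact hb.elim hij n2
    · simp only [(hwd _ _).symm, false_or, hw.eq_iff] at hb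
      exact hb.elim (fun h => n1 h.symm) fun h => hij (hinj h)

/-- A rainbow `K_{l,l}` whose colors avoid its vertices contains, after extension, a loose
cycle of length `2 * l`. -/
theorem containsLooseCycle_of_rainbow_biclique {V : Type*} [DecidableEq V] (H : FinHypergraph V)
    {l : ℕ} (hl : 2 ≤ l) (f : Fin l ⊕ Fin l → V) (hf : Function.Injective f)
    (c : Fin l × Fin l → V) (hc : Function.Injective c) (hcf : ∀ p k, c p ≠ f k)
    (hH : ∀ i j, insert (c (i, j)) {f (Sum.inl i), f (Sum.inr j)} ∈ H) :
    ContainsLooseCycle H (2 * l) := by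
  let nx : Fin (2 * l) → Fin (2 * l) := fun i => ⟨((i : ℕ) + 1) % (2 * l), Nat.mod_lt _ (by omega)⟩
  let half : Fin (2 * l) → Fin l := fun i => ⟨(i : ℕ) / 2, by omega⟩
  -- The cycle alternates sides, x₀ y₀ x₁ y₁ …, and `d i` is the color of its edge from `w i` to `w
  -- (nx i)`.
  let w : Fin (2 * l) → V := fun i =>
    if (i : ℕ) % 2 = 0 then f (Sum.inl (half i)) else f (Sum.inr (half i))
  let d : Fin (2 * l) → V := fun i =>
    if (i : ℕ) % 2 = 0 then c (half i, half (nx i)) else c (half (nx i), half i)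
  have hval : ∀ i : Fin (2 * l), ((nx i : ℕ) = i + 1 ∧ (i : ℕ) + 1 < 2 * l) ∨
      ((nx i : ℕ) = 0 ∧ (i : ℕ) + 1 = 2 * l) := by
    intro i
    change (((i : ℕ) + 1) % (2 * l) = i + 1 ∧ _) ∨ (((i : ℕ) + 1) % (2 * l) = 0 ∧ _)
    rcases Nat.lt_or_ge ((i : ℕ) + 1) (2 * l) with h | h
    · exact Or.inl ⟨Nat.mod_eq_of_lt h, h⟩
    · have : (i : ℕ) + 1 = 2 * l := by omega
      exact Or.inr ⟨by rw [this, Nat.mod_self], this⟩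
  have hhalf : ∀ i, (half i : ℕ) = (i : ℕ) / 2 := fun _ => rfl
  have hw : Function.Injective w := by
    intro i j hij
    have h1 := hhalf i
    have h2 := hhalf j
    simp only [w] at hij
    split_ifs at hij with hi hj hj <;> have := hf hij <;>
      simp only [Sum.inl.injEq, Sum.inr.injEq, reduceCtorEq, Fin.ext_iff] at this <;> ext <;> omega
  have hd : Function.Injective d := by
    intro i j hij
    have h1 := hhalf i
    have h2 := hhalf j
    have h3 := hhalf (nx i)
    have h4 := hhalf (nx j)
    have h5 := hval i
    have h6 := hval j
    simp only [d] at hij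
    split_ifs at hij with hi hj hj <;> have := hc hij <;>
      simp only [Prod.mk.injEq, Fin.ext_iff] at this <;> ext <;> omega
  have hwd : ∀ i j, d i ≠ w j := by
    intro i j
    simp only [d, w]
    split_ifs <;> exact hcf _ _
  refine ⟨_, _, ?_, isLooseCycle_of_injective (by omega) w d hw hd hwd nx fun _ => rfl⟩
  intro i
  have h5 := hval i
  by_cases hi : (i : ℕ) % 2 = 0
  · have hi' : ¬ (nx i : ℕ) % 2 = 0 := by omega
    simp only [d, w, hi, hi', if_true, if_false]
    exact hH _ _
  · have hi' : (nx i : ℕ) % 2 = 0 := by omega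
    simp only [d, w, hi, hi', if_true, if_false]
    rw [Finset.pair_comm]
    exact hH _ _

/-! ### Rare edges are few -/

theorem mem_completeBipartiteOn {V : Type*} [DecidableEq V] {X Y : Finset V} {e : Finset V} :
    e ∈ completeBipartiteOn X Y ↔ ∃ x ∈ X, ∃ y ∈ Y, e = {x, y} := by
  simp only [completeBipartiteOn, Finset.mem_image, Finset.mem_product, Prod.exists]
  constructor
  · rintro ⟨x, y, ⟨hx, hy⟩, rfl⟩
    exact ⟨x, hx, y, hy, rfl⟩
  · rintro ⟨x, hx, y, hy, rfl⟩
    exact ⟨x, y, ⟨hx, hy⟩, rfl⟩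

/-- The number of edges of color `z` at the vertex `v`. -/
def colorDegree {V : Type*} [DecidableEq V] (G : FinHypergraph V) (col : Finset V → V)
    (v z : V) : ℕ :=
  (G.filter fun e => v ∈ e ∧ col e = z).card

/-- The edges whose color has degree at most `M / R` at each of their vertices. -/
def rareEdges {V : Type*} [DecidableEq V] (G : FinHypergraph V) (col : Finset V → V)
    (M R : ℕ) : FinHypergraph V :=
  G.filter fun e => ∀ v ∈ e, R * colorDegree G col v (col e) ≤ M

/-- Rarity supplies exactly the row and column bounds of `exists_rainbow_biclique`, so too many rare
edges would yield a loose cycle. -/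
theorem card_rareEdges_pow_le {V : Type*} [DecidableEq V] {l : ℕ} (hl : 2 ≤ l) (X Y : Finset V)
    (hXY : Disjoint X Y) (col : Finset V → V)
    (hcol : ∀ e ∈ completeBipartiteOn X Y, col e ∉ e)
    (hfree : ¬ ContainsLooseCycle
      ((completeBipartiteOn X Y).image fun e => insert (col e) e) (2 * l))
    (R : ℕ) (hR : 0 < R) (hRM : R ≤ X.card + Y.card) :
    R * (rareEdges (completeBipartiteOn X Y) col (X.card + Y.card) R).card ^ (l ^ 2)
      ≤ (4 * l ^ 2 + l ^ 4 + 2 * l ^ 3) * (X.card + Y.card) ^ (2 * l ^ 2) := by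
  classical
  set G := completeBipartiteOn X Y with hG
  set M := X.card + Y.card with hM
  set H := rareEdges G col M R with hH
  have hW : Fintype.card {v // v ∈ X ∪ Y} = M := by
    rw [Fintype.card_coe, Finset.card_union_of_disjoint hXY]
  -- Pairs are oriented from `X` to `Y`, so related vertices are distinct.
  let r : {v // v ∈ X ∪ Y} → {v // v ∈ X ∪ Y} → Prop := fun x y =>
    (x : V) ∈ X ∧ (y : V) ∈ Y ∧ ({(x : V), (y : V)} : Finset V) ∈ H
  have hHmem : ∀ {e}, e ∈ H → e ∈ G ∧ ∀ v ∈ e, R * colorDegree G col v (col e) ≤ M := by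
    intro e he
    exact Finset.mem_filter.1 he
  have hpairs : H.card ≤ (Finset.univ.filter fun p : {v // v ∈ X ∪ Y} × {v // v ∈ X ∪ Y} =>
      r p.1 p.2).card := by
    refine Finset.card_le_card_of_surjOn (fun p => {(p.1 : V), (p.2 : V)}) ?_
    intro e he
    obtain ⟨x, hx, y, hy, rfl⟩ := mem_completeBipartiteOn.1 (hHmem (Finset.mem_coe.1 he)).1
    refine ⟨(⟨x, Finset.mem_union_left _ hx⟩, ⟨y, Finset.mem_union_right _ hy⟩), ?_, rfl⟩
    simpa [r] using ⟨hx, hy, he⟩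
  -- A single edge of color `z` in `H` at `x` certifies that `z` has small degree there, which then
  -- bounds all of `s`.
  have hmult : ∀ (x : {v // v ∈ X ∪ Y}) (z : V) (s : Finset {v // v ∈ X ∪ Y}),
      (∀ y ∈ s, ({(x : V), (y : V)} : Finset V) ∈ H ∧ col {(x : V), (y : V)} = z) →
      (∀ y ∈ s, y ≠ x) → R * s.card ≤ M := by
    intro x z s hs hsx
    rcases s.eq_empty_or_nonempty with rfl | ⟨y0, hy0⟩
    · simp
    · obtain ⟨h1, h2⟩ := hs y0 hy0
      have h3 := (hHmem h1).2 x (by simp)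
      rw [h2] at h3
      refine (Nat.mul_le_mul_left R ?_).trans h3
      refine Finset.card_le_card_of_injOn (fun y => {(x : V), (y : V)}) ?_ ?_
      · intro y hy
        obtain ⟨h4, h5⟩ := hs y hy
        exact Finset.mem_coe.2 (Finset.mem_filter.2 ⟨(hHmem h4).1, by simp, h5⟩)
      · intro y hy y' hy' hyy
        have : (y : V) ∈ ({(x : V), (y' : V)} : Finset V) := by
          have hyy' : ({(x : V), (y : V)} : Finset V) = {(x : V), (y' : V)} := hyy
          rw [← hyy']; simp
        simp only [Finset.mem_insert, Finset.mem_singleton] at this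
        rcases this with h | h
        · exact absurd (Subtype.ext h) (hsx y hy)
        · exact Subtype.ext h
  have hne : ∀ {x y : {v // v ∈ X ∪ Y}}, r x y → x ≠ y := by
    rintro x y ⟨hx, hy, -⟩ rfl
    exact Finset.disjoint_left.1 hXY hx hy
  by_contra hcon
  rw [not_le] at hcon
  obtain ⟨f, hf, hfr, hfc, hfv⟩ := exists_rainbow_biclique (κ := V) (W := {v // v ∈ X ∪ Y})
    Subtype.val Subtype.val_injective r (fun x y => col {(x : V), (y : V)})
    (by
      rintro x y ⟨hx, hy, hxy⟩
      have := hcol _ (hHmem hxy).1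
      simp only [Finset.mem_insert, Finset.mem_singleton, not_or] at this
      exact this)
    l R (by omega) hR (hW ▸ hRM)
    (by
      intro x z
      rw [hW]
      refine hmult x z _ ?_ ?_
      · intro y hy
        obtain ⟨h1, h2⟩ := (Finset.mem_filter.1 hy).2
        exact ⟨h1.2.2, h2⟩
      · intro y hy
        exact (hne (Finset.mem_filter.1 hy).2.1).symm)
    (by
      intro y z
      rw [hW]
      refine hmult y z _ ?_ ?_
      · intro x hx
        obtain ⟨h1, h2⟩ := (Finset.mem_filter.1 hx).2
        rw [Finset.pair_comm]
        exact ⟨h1.2.2, h2⟩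
      · intro x hx
        exact hne (Finset.mem_filter.1 hx).2.1)
    (by
      rw [hW]
      exact hcon.trans_le (Nat.mul_le_mul_left R (Nat.pow_le_pow_left hpairs _)))
  refine hfree (containsLooseCycle_of_rainbow_biclique _ hl (fun k => (f k : V))
    (Subtype.val_injective.comp hf)
    (fun p => col {(f (Sum.inl p.1) : V), (f (Sum.inr p.2) : V)}) (fun p q h => hfc p q h)
    (fun p k => hfv p.1 p.2 k) ?_)
  intro i j
  exact Finset.mem_image_of_mem (fun e => insert (col e) e) (hHmem (hfr i j).2.2).1

/-! ### Counting small sets and level functions -/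

theorem card_filter_card_le {κ : Type*} [DecidableEq κ] (Z : Finset κ) (r : ℕ) :
    (Z.powerset.filter fun S => S.card ≤ r).card ≤ (Z.card + 1) ^ r := by
  induction r with
  | zero =>
    rw [pow_zero, Finset.card_le_one]
    intro a ha b hb
    simp only [Finset.mem_filter, Nat.le_zero, Finset.card_eq_zero] at ha hb
    rw [ha.2, hb.2]
  | succ r ih =>
    set F := Z.powerset.filter fun S => S.card ≤ r with hF
    have hsub : (Z.powerset.filter fun S => S.card ≤ r + 1)
        ⊆ F ∪ (Z ×ˢ F).image fun p => insert p.1 p.2 := by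
      intro S hS
      simp only [Finset.mem_filter, Finset.mem_powerset] at hS
      rw [Finset.mem_union]
      rcases S.eq_empty_or_nonempty with rfl | ⟨a, ha⟩
      · left; simp [hF]
      · right
        refine Finset.mem_image.2 ⟨(a, S.erase a), ?_, Finset.insert_erase ha⟩
        simp only [hF, Finset.mem_product, Finset.mem_filter, Finset.mem_powerset]
        refine ⟨hS.1 ha, (Finset.erase_subset _ _).trans hS.1, ?_⟩
        rw [Finset.card_erase_of_mem ha]; omega
    calc _ ≤ F.card + Z.card * F.card := by
          refine (Finset.card_le_card hsub).trans ((Finset.card_union_le _ _).trans ?_)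
          exact Nat.add_le_add_left (Finset.card_image_le.trans (Finset.card_product _ _).le) _
      _ = (Z.card + 1) * F.card := by ring
      _ ≤ (Z.card + 1) * (Z.card + 1) ^ r := Nat.mul_le_mul_left _ ih
      _ = _ := (pow_succ' _ _).symm

/-- Give `f` the weight 2^(S - ∑ f), which is at least 1 on the counted functions. The total weight
factors into geometric series, each at most 2, so the bound does not depend on `K`. -/
theorem card_filter_sum_le {E : Type*} [Fintype E] [DecidableEq E] (K S : ℕ) :
    ((Fintype.piFinset fun _ : E => Finset.range K).filter fun f => ∑ e, f e ≤ S).card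
      ≤ 2 ^ (Fintype.card E + S) := by
  set Λ := (Fintype.piFinset fun _ : E => Finset.range K).filter fun f => ∑ e, f e ≤ S with hΛ
  have h : (Λ.card : ℝ) ≤ 2 ^ (Fintype.card E + S) := by
    calc (Λ.card : ℝ) = ∑ f ∈ Λ, (1 : ℝ) := by simp
      _ ≤ ∑ f ∈ Λ, 2 ^ S * ∏ e, (1 / 2 : ℝ) ^ f e := by
          refine Finset.sum_le_sum fun f hf => ?_
          have := (Finset.mem_filter.1 hf).2
          rw [Finset.prod_pow_eq_pow_sum, one_div, inv_pow, ← div_eq_mul_inv,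
            le_div_iff₀ (by positivity), one_mul]
          exact pow_le_pow_right₀ (by norm_num) this
      _ ≤ ∑ f ∈ Fintype.piFinset fun _ : E => Finset.range K, 2 ^ S * ∏ e, (1 / 2 : ℝ) ^ f e :=
          Finset.sum_le_sum_of_subset_of_nonneg (Finset.filter_subset _ _)
            fun _ _ _ => by positivity
      _ = 2 ^ S * ∏ _e : E, ∑ j ∈ Finset.range K, (1 / 2 : ℝ) ^ j := by
          rw [← Finset.mul_sum, Finset.prod_univ_sum]
      _ ≤ 2 ^ S * ∏ _e : E, (2 : ℝ) := by
          refine mul_le_mul_of_nonneg_left (Finset.prod_le_prod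
            (fun _ _ => Finset.sum_nonneg fun _ _ => by positivity)
            fun _ _ => sum_geometric_two_le K) (by positivity)
      _ = 2 ^ (Fintype.card E + S) := by
          rw [Finset.prod_const, Finset.card_univ, pow_add, mul_comm]
  exact_mod_cast h

/-- Functions choosing for each `e` a level `j`, of total at most `S`, and a value in a set of at
most `2 ^ (1 + A * j)` elements. -/
theorem card_biUnion_piFinset_le {E κ : Type*} [Fintype E] [DecidableEq E] [DecidableEq κ]
    (T : E → ℕ → Finset κ) (A K S : ℕ) (hT : ∀ e, ∀ j < K, (T e j).card ≤ 2 ^ (1 + A * j)) :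
    (((Fintype.piFinset fun _ : E => Finset.range K).filter fun f => ∑ e, f e ≤ S).biUnion
      fun f => Fintype.piFinset fun e => T e (f e)).card
      ≤ 2 ^ (2 * Fintype.card E + (A + 1) * S) := by
  refine (Finset.card_biUnion_le_card_mul _ _ (2 ^ (Fintype.card E + A * S)) ?_).trans ?_
  · intro f hf
    obtain ⟨h1, h2⟩ := Finset.mem_filter.1 hf
    rw [Fintype.mem_piFinset] at h1
    rw [Fintype.card_piFinset]
    calc ∏ e, (T e (f e)).card ≤ ∏ e, 2 ^ (1 + A * f e) :=
          Finset.prod_le_prod' fun e _ => hT e _ (Finset.mem_range.1 (h1 e))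
      _ = 2 ^ (Fintype.card E + A * ∑ e, f e) := by
          rw [Finset.prod_pow_eq_pow_sum, Finset.sum_add_distrib, Finset.mul_sum]
          simp
      _ ≤ _ := Nat.pow_le_pow_right (by norm_num)
          (Nat.add_le_add_left (Nat.mul_le_mul_left _ h2) _)
  · refine (Nat.mul_le_mul_right _ (card_filter_sum_le K S)).trans (le_of_eq ?_)
    rw [← pow_add]; congr 1; ring

theorem exists_scale {L m : ℕ} (hL : 0 < L) (hm : 0 < m) :
    ∃ J, 2 ^ (L * J) * (J + 1) ≤ m ∧ m + 1 ≤ 2 ^ (2 * L * (J + 1)) := by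
  -- The factor 2 reserves half of the exponent to absorb `J + 1 ≤ 2 ^ (L * J)`.
  refine ⟨Nat.log 2 m / (2 * L), ?_, ?_⟩
  · set J := Nat.log 2 m / (2 * L) with hJ
    have h1 : J + 1 ≤ 2 ^ (L * J) :=
      (Nat.lt_two_pow_self (n := J)).trans_le
        (Nat.pow_le_pow_right (by norm_num) (Nat.le_mul_of_pos_left _ hL))
    calc 2 ^ (L * J) * (J + 1) ≤ 2 ^ (L * J) * 2 ^ (L * J) := Nat.mul_le_mul_left _ h1
      _ = 2 ^ (2 * L * J) := by rw [← pow_add]; congr 1; ring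
      _ ≤ 2 ^ Nat.log 2 m := Nat.pow_le_pow_right (by norm_num) (Nat.mul_div_le _ _)
      _ ≤ m := Nat.pow_log_le_self 2 hm.ne'
  · refine (Nat.lt_pow_succ_log_self (by norm_num : 1 < 2) m).trans_le
      (Nat.pow_le_pow_right (by norm_num) ?_)
    exact Nat.lt_mul_div_succ _ (by positivity)

/-! ### Popular colors and levels of edges -/

/-- The colors in `Z` that occur more than `M / R` times at `v`. -/
def popularColors {V : Type*} [DecidableEq V] (G : FinHypergraph V) (col : Finset V → V)
    (Z : Finset V) (M R : ℕ) (v : V) : Finset V :=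
  Z.filter fun z => M < R * colorDegree G col v z

/-- Color classes at `v` are disjoint, each popular one has more than M / R edges, and `v` has at
most M edges. -/
theorem card_popularColors_le {V : Type*} [DecidableEq V] (G : FinHypergraph V)
    (col : Finset V → V) (Z : Finset V) (M R : ℕ) (v : V) (hM : 0 < M)
    (hdeg : (G.filter fun e => v ∈ e).card ≤ M) :
    (popularColors G col Z M R v).card ≤ R := by
  set S := popularColors G col Z M R v with hS
  have h1 : S.card * M ≤ ∑ z ∈ S, R * colorDegree G col v z := by
    rw [← smul_eq_mul]
    exact Finset.card_nsmul_le_sum _ _ _ fun z hz => (Finset.mem_filter.1 hz).2.le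
  have h2 : ∑ z ∈ S, colorDegree G col v z ≤ M := by
    refine le_trans ?_ hdeg
    unfold colorDegree
    rw [← Finset.card_biUnion (t := fun z => G.filter fun e => v ∈ e ∧ col e = z)]
    · refine Finset.card_le_card fun e he => ?_
      obtain ⟨z, -, hz⟩ := Finset.mem_biUnion.1 he
      obtain ⟨h3, h4, -⟩ := Finset.mem_filter.1 hz
      exact Finset.mem_filter.2 ⟨h3, h4⟩
    · intro z _ z' _ hzz
      refine Finset.disjoint_left.2 fun e he he' => ?_
      exact hzz ((Finset.mem_filter.1 he).2.2.symm.trans (Finset.mem_filter.1 he').2.2)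
  rw [← Finset.mul_sum] at h1
  exact Nat.le_of_mul_le_mul_right (h1.trans (Nat.mul_le_mul_left R h2)) hM

/-- The level of `e` is the least j with `e ∉ H j`, so it is at most the number of the sets `H j`
containing `e`. Summing over edges and exchanging sums gives a geometric series. -/
theorem exists_level {V : Type*} [DecidableEq V] (G : FinHypergraph V) (H : ℕ → FinHypergraph V)
    (J B : ℕ) (hB : ∀ j ≤ J, (H j).card * 2 ^ j ≤ B) :
    ∃ f : {e // e ∈ G} → ℕ, (∀ e, f e < J + 2) ∧ ∑ e, f e ≤ 2 * B ∧
      ∀ e, f e ≤ J → (e : Finset V) ∉ H (f e) := by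
  -- The guard `j ≤ J` makes `J + 1` the level of an edge lying in every `H j`.
  have hex : ∀ e : {e // e ∈ G}, ∃ j, j ≤ J → (e : Finset V) ∉ H j :=
    fun e => ⟨J + 1, fun h => absurd h (by omega)⟩
  have hle : ∀ e, Nat.find (hex e) ≤ J + 1 :=
    fun e => Nat.find_min' _ fun h => absurd h (by omega)
  refine ⟨fun e => Nat.find (hex e), fun e => Nat.lt_succ_of_le (hle e), ?_,
    fun e => Nat.find_spec (hex e)⟩
  have h1 : ∀ e : {e // e ∈ G}, Nat.find (hex e)
      ≤ ∑ j ∈ Finset.range (J + 1), if (e : Finset V) ∈ H j then 1 else 0 := by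
    intro e
    rw [← Finset.card_filter]
    conv_lhs => rw [← Finset.card_range (Nat.find (hex e))]
    refine Finset.card_le_card fun j hj => ?_
    have hj' := Finset.mem_range.1 hj
    refine Finset.mem_filter.2 ⟨Finset.mem_range.2 (hj'.trans_le (hle e)), ?_⟩
    have := Nat.find_min (hex e) hj'
    simp only [Classical.not_imp, not_not] at this
    exact this.2
  have h2 : ∀ j, (∑ e : {e // e ∈ G}, if (e : Finset V) ∈ H j then 1 else 0) ≤ (H j).card := by
    intro j
    rw [← Finset.card_filter]
    refine Finset.card_le_card_of_injOn Subtype.val ?_ (Subtype.val_injective.injOn)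
    intro e he
    exact Finset.mem_coe.2 (Finset.mem_filter.1 (Finset.mem_coe.1 he)).2
  have h3 : ∑ j ∈ Finset.range (J + 1), (H j).card ≤ 2 * B := by
    have : ∑ j ∈ Finset.range (J + 1), ((H j).card : ℝ) ≤ 2 * B := by
      calc _ ≤ ∑ j ∈ Finset.range (J + 1), (B : ℝ) * (1 / 2) ^ j := by
            refine Finset.sum_le_sum fun j hj => ?_
            have := hB j (Nat.lt_succ_iff.1 (Finset.mem_range.1 hj))
            rw [one_div, inv_pow, ← div_eq_mul_inv, le_div_iff₀ (by positivity)]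
            exact_mod_cast this
        _ = B * ∑ j ∈ Finset.range (J + 1), (1 / 2 : ℝ) ^ j := by rw [Finset.mul_sum]
        _ ≤ B * 2 := mul_le_mul_of_nonneg_left (sum_geometric_two_le _) (Nat.cast_nonneg _)
        _ = 2 * B := mul_comm _ _
    exact_mod_cast this
  calc _ ≤ ∑ e : {e // e ∈ G}, ∑ j ∈ Finset.range (J + 1),
        (if (e : Finset V) ∈ H j then 1 else 0) := Finset.sum_le_sum fun e _ => h1 e
    _ = ∑ j ∈ Finset.range (J + 1), ∑ e : {e // e ∈ G},
        (if (e : Finset V) ∈ H j then 1 else 0) := Finset.sum_comm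
    _ ≤ _ := (Finset.sum_le_sum fun j _ => h2 j).trans h3

theorem card_completeBipartiteOn_le {V : Type*} [DecidableEq V] (X Y : Finset V) :
    (completeBipartiteOn X Y).card ≤ (X.card + Y.card) ^ 2 := by
  refine (Finset.card_image_le.trans (Finset.card_product _ _).le).trans ?_
  nlinarith [Nat.zero_le X.card, Nat.zero_le Y.card]

theorem degree_completeBipartiteOn_le {V : Type*} [DecidableEq V] (X Y : Finset V) (v : V) :
    ((completeBipartiteOn X Y).filter fun e => v ∈ e).card ≤ X.card + Y.card := by
  refine le_trans (Finset.card_le_card ?_)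
    ((Finset.card_image_le (s := X ∪ Y) (f := fun w => ({v, w} : Finset V))).trans
      (Finset.card_union_le _ _))
  intro e he
  obtain ⟨he, hv⟩ := Finset.mem_filter.1 he
  obtain ⟨x, hx, y, hy, rfl⟩ := mem_completeBipartiteOn.1 he
  simp only [Finset.mem_insert, Finset.mem_singleton] at hv
  rcases hv with rfl | rfl
  · exact Finset.mem_image.2 ⟨y, Finset.mem_union_right _ hy, rfl⟩
  · exact Finset.mem_image.2 ⟨x, Finset.mem_union_left _ hx, Finset.pair_comm _ _⟩

theorem card_rareEdges_mul_le {V : Type*} [DecidableEq V] {l : ℕ} (hl : 2 ≤ l) (X Y : Finset V)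
    (hXY : Disjoint X Y) (col : Finset V → V)
    (hcol : ∀ e ∈ completeBipartiteOn X Y, col e ∉ e)
    (hfree : ¬ ContainsLooseCycle
      ((completeBipartiteOn X Y).image fun e => insert (col e) e) (2 * l))
    (j : ℕ) (hj : 2 ^ (l ^ 2 * j) ≤ X.card + Y.card) :
    (rareEdges (completeBipartiteOn X Y) col (X.card + Y.card) (2 ^ (l ^ 2 * j))).card * 2 ^ j
      ≤ (4 * l ^ 2 + l ^ 4 + 2 * l ^ 3) * (X.card + Y.card) ^ 2 := by
  have h := card_rareEdges_pow_le hl X Y hXY col hcol hfree _ (by positivity) hj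
  set C := 4 * l ^ 2 + l ^ 4 + 2 * l ^ 3
  set H := rareEdges (completeBipartiteOn X Y) col (X.card + Y.card) (2 ^ (l ^ 2 * j))
  have hl2 : l ^ 2 ≠ 0 := by positivity
  have hC : 1 ≤ C := by
    have : 0 < C := by positivity
    exact this
  -- Comparing powers of exponent l² turns 2^j into the scale R = 2^(l² j), and C is replaced by the
  -- larger C^(l²).
  rw [← Nat.pow_le_pow_iff_left hl2, mul_pow, mul_pow, ← pow_mul, ← pow_mul]
  calc _ = 2 ^ (l ^ 2 * j) * H.card ^ (l ^ 2) := by rw [mul_comm j, mul_comm]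
    _ ≤ C * (X.card + Y.card) ^ (2 * l ^ 2) := h
    _ ≤ _ := Nat.mul_le_mul_right _ (Nat.le_self_pow hl2 C)

/-! ### Palettes and the colors they allow -/

/-- The possible colors of an edge of level `j`: those popular at one of its ends, as listed
by `P`, or arbitrary if `j` is larger than `J`. -/
def levelColors {V : Type*} [DecidableEq V] (W Z : Finset V) (J : ℕ)
    (P : {v // v ∈ W} × Fin (J + 1) → Finset V) (e : Finset V) (j : ℕ) : Finset V :=
  if j ≤ J then
    (Finset.univ.filter fun v : {v // v ∈ W} => (v : V) ∈ e).biUnion fun v => P (v, Fin.ofNat _ j)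
  else Z

theorem card_levelColors_le {V : Type*} [DecidableEq V] (W Z : Finset V) (J L A : ℕ)
    (P : {v // v ∈ W} × Fin (J + 1) → Finset V) (hP : ∀ a, (P a).card ≤ 2 ^ (L * (a.2 : ℕ)))
    (hLA : L ≤ A) (hZ : Z.card ≤ 2 ^ (A * (J + 1))) (e : Finset V) (he : e.card ≤ 2) (j : ℕ) :
    (levelColors W Z J P e j).card ≤ 2 ^ (1 + A * j) := by
  unfold levelColors
  split_ifs with hj
  · have h1 : (Finset.univ.filter fun v : {v // v ∈ W} => (v : V) ∈ e).card ≤ 2 := by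
      refine le_trans (Finset.card_le_card_of_injOn Subtype.val ?_ Subtype.val_injective.injOn) he
      intro v hv
      exact Finset.mem_coe.2 (Finset.mem_filter.1 (Finset.mem_coe.1 hv)).2
    refine (Finset.card_biUnion_le_card_mul _ _ (2 ^ (A * j)) ?_).trans ?_
    · intro v _
      refine (hP _).trans (Nat.pow_le_pow_right (by norm_num) ?_)
      simp only [Fin.val_ofNat, Nat.mod_eq_of_lt (Nat.lt_succ_of_le hj)]
      exact Nat.mul_le_mul_right _ hLA
    · rw [pow_add, pow_one]
      exact Nat.mul_le_mul_right _ h1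
  -- Here `j ≥ J + 1`, so even an arbitrary color of `Z` costs no more than 2^(A j).
  · refine hZ.trans (Nat.pow_le_pow_right (by norm_num) ?_)
    have : A * (J + 1) ≤ A * j := Nat.mul_le_mul_left _ (by omega)
    omega

/-- The systems of lists of popular colors. -/
def palettes {V : Type*} [DecidableEq V] (W Z : Finset V) (L J : ℕ) :
    Finset ({v // v ∈ W} × Fin (J + 1) → Finset V) :=
  Fintype.piFinset fun a => Z.powerset.filter fun S => S.card ≤ 2 ^ (L * (a.2 : ℕ))

theorem card_palettes_le {V : Type*} [DecidableEq V] (W Z : Finset V) (L J : ℕ) :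
    (palettes W Z L J).card ≤ (Z.card + 1) ^ (2 ^ (L * J) * (J + 1) * W.card) := by
  rw [palettes, Fintype.card_piFinset]
  calc _ ≤ ∏ _a : {v // v ∈ W} × Fin (J + 1), (Z.card + 1) ^ 2 ^ (L * J) := by
        refine Finset.prod_le_prod' fun a _ => (card_filter_card_le Z _).trans ?_
        refine Nat.pow_le_pow_right (Nat.succ_pos _) (Nat.pow_le_pow_right (by norm_num) ?_)
        exact Nat.mul_le_mul_left _ (Nat.lt_succ_iff.1 a.2.2)
    _ = _ := by
        rw [Finset.prod_const, Finset.card_univ, Fintype.card_prod, Fintype.card_coe,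
          Fintype.card_fin, ← pow_mul]
        congr 1; ring

/-- The palette lists the colors that really are popular. Failing to be rare at scale 2^(l² j) means
having a color popular at some end. -/
theorem exists_palette_level {V : Type*} [DecidableEq V] {l : ℕ} (hl : 2 ≤ l) (X Y : Finset V)
    (hXY : Disjoint X Y) (hpos : 0 < X.card + Y.card) (col : Finset V → V)
    (hcol : ∀ e ∈ completeBipartiteOn X Y, col e ∉ e)
    (hfree : ¬ ContainsLooseCycle
      ((completeBipartiteOn X Y).image fun e => insert (col e) e) (2 * l))
    (Z : Finset V) (hZ : ∀ e ∈ completeBipartiteOn X Y, col e ∈ Z)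
    (J : ℕ) (hJ : 2 ^ (l ^ 2 * J) ≤ X.card + Y.card) :
    ∃ P ∈ palettes (X ∪ Y) Z (l ^ 2) J, ∃ f : {e // e ∈ completeBipartiteOn X Y} → ℕ,
      (∀ e, f e < J + 2) ∧
      ∑ e, f e ≤ 2 * ((4 * l ^ 2 + l ^ 4 + 2 * l ^ 3) * (X.card + Y.card) ^ 2) ∧
      ∀ e : {e // e ∈ completeBipartiteOn X Y}, col e ∈ levelColors (X ∪ Y) Z J P e (f e) := by
  set G := completeBipartiteOn X Y with hG
  set M := X.card + Y.card with hM
  obtain ⟨f, hf1, hf2, hf3⟩ := exists_level G (fun j => rareEdges G col M (2 ^ (l ^ 2 * j))) J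
    ((4 * l ^ 2 + l ^ 4 + 2 * l ^ 3) * M ^ 2) fun j hj =>
      card_rareEdges_mul_le hl X Y hXY col hcol hfree j
        ((Nat.pow_le_pow_right (by norm_num) (Nat.mul_le_mul_left _ hj)).trans hJ)
  refine ⟨fun a => popularColors G col Z M (2 ^ (l ^ 2 * (a.2 : ℕ))) a.1, ?_, f, hf1, hf2, ?_⟩
  · refine Fintype.mem_piFinset.2 fun a => Finset.mem_filter.2 ⟨?_, ?_⟩
    · exact Finset.mem_powerset.2 (Finset.filter_subset _ _)
    · exact card_popularColors_le G col Z M _ _ hpos (degree_completeBipartiteOn_le X Y _)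
  · rintro ⟨e, he⟩
    unfold levelColors
    split_ifs with hj
    · have h1 := hf3 _ hj
      simp only [rareEdges, Finset.mem_filter, he, true_and, not_forall, not_le] at h1
      obtain ⟨v, hv, hlt⟩ := h1
      have hvW : v ∈ X ∪ Y := by
        obtain ⟨x, hx, y, hy, rfl⟩ := mem_completeBipartiteOn.1 he
        simp only [Finset.mem_insert, Finset.mem_singleton] at hv
        rcases hv with rfl | rfl
        · exact Finset.mem_union_left _ hx
        · exact Finset.mem_union_right _ hy
      refine Finset.mem_biUnion.2 ⟨⟨v, hvW⟩, Finset.mem_filter.2 ⟨Finset.mem_univ _, hv⟩, ?_⟩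
      refine Finset.mem_filter.2 ⟨hZ e he, ?_⟩
      simpa only [Fin.val_ofNat, Nat.mod_eq_of_lt (Nat.lt_succ_of_le hj)] using hlt
    · exact hZ e he

/-! ### The final count -/

/-- The lists have total length at most mM, and each entry costs at most 4m bits. Since m² ≤ M, the
product is at most 4M². -/
theorem card_palettes_le_two_pow {V : Type*} [DecidableEq V] (W Z : Finset V) (L J m M : ℕ)
    (hJ : 2 ^ (L * J) * (J + 1) ≤ m) (hmM : m * m ≤ M) (hM : M < (m + 1) * (m + 1))
    (hW : W.card ≤ M) (hZ : Z.card ≤ M ^ 2) : (palettes W Z L J).card ≤ 2 ^ (4 * M ^ 2) := by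
  have h1 : Z.card + 1 ≤ 2 ^ (4 * m) := by
    calc Z.card + 1 ≤ M ^ 2 + 1 := Nat.add_le_add_right hZ 1
      _ ≤ ((m + 1) * (m + 1)) ^ 2 := Nat.pow_lt_pow_left hM (by norm_num)
      _ = (m + 1) ^ 4 := by ring
      _ ≤ (2 ^ m) ^ 4 := Nat.pow_le_pow_left (Nat.lt_two_pow_self) 4
      _ = 2 ^ (4 * m) := by rw [← pow_mul, mul_comm]
  refine (card_palettes_le W Z L J).trans ((Nat.pow_le_pow_left h1 _).trans ?_)
  rw [← pow_mul]
  refine Nat.pow_le_pow_right (by norm_num) ?_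
  calc 4 * m * (2 ^ (L * J) * (J + 1) * W.card) ≤ 4 * m * (m * M) :=
        Nat.mul_le_mul_left _ (Nat.mul_le_mul hJ hW)
    _ = 4 * (m * m) * M := by ring
    _ ≤ 4 * M * M := Nat.mul_le_mul_right _ (Nat.mul_le_mul_left _ hmM)
    _ = 4 * M ^ 2 := by ring

theorem ncard_edgeColoring_le {V : Type*} [DecidableEq V] [Finite V] {l : ℕ} (hl : 2 ≤ l)
    (X Y : Finset V) (hXY : Disjoint X Y) (hX : X.Nonempty) (Z : Finset V) :
    {N : EdgeColoring (completeBipartiteOn X Y) |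
        N.colorSet = Z ∧ ¬ ContainsLooseCycle N.extension (2 * l)}.ncard
      ≤ 2 ^ ((6 + (8 * l ^ 2 + 1) * (2 * (4 * l ^ 2 + l ^ 4 + 2 * l ^ 3)))
        * (X.card + Y.card) ^ 2) := by
  classical
  set G := completeBipartiteOn X Y with hG
  set M := X.card + Y.card with hM
  set C := 4 * l ^ 2 + l ^ 4 + 2 * l ^ 3 with hC
  set 𝒩 := {N : EdgeColoring G | N.colorSet = Z ∧ ¬ ContainsLooseCycle N.extension (2 * l)}
    with h𝒩
  obtain ⟨x₀, hx₀⟩ := hX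
  have hMpos : 0 < M := Nat.add_pos_left (Finset.card_pos.2 ⟨x₀, hx₀⟩) _
  have hGM : G.card ≤ M ^ 2 := card_completeBipartiteOn_le X Y
  -- A coloring with color set exactly `Z` forces `|Z| ≤ |G| ≤ M²`, which removes all dependence on
  -- the size of `V`.
  rcases 𝒩.eq_empty_or_nonempty with h0 | ⟨N₀, hN₀⟩
  · rw [h0, Set.ncard_empty]; exact Nat.zero_le _
  have hZM : Z.card ≤ M ^ 2 := by
    rw [← hN₀.1]
    exact Finset.card_image_le.trans (by rwa [Finset.card_attach])
  set m := Nat.sqrt M with hm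
  have hmM : m * m ≤ M := Nat.sqrt_le M
  have hMm : M < (m + 1) * (m + 1) := Nat.lt_succ_sqrt M
  have hmpos : 0 < m := Nat.sqrt_pos.2 hMpos
  obtain ⟨J, hJ1, hJ2⟩ := exists_scale (L := l ^ 2) (by positivity) hmpos
  have hJM : 2 ^ (l ^ 2 * J) ≤ M :=
    (Nat.le_mul_of_pos_right _ (Nat.succ_pos J)).trans
      (hJ1.trans ((Nat.le_mul_of_pos_left _ hmpos).trans hmM))
  -- The constant 8 l² is the fourth power of m + 1 ≤ 2^(2 l² (J+1)), read in the exponent.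
  have hZJ : Z.card ≤ 2 ^ (8 * l ^ 2 * (J + 1)) := by
    calc Z.card ≤ M ^ 2 := hZM
      _ ≤ ((m + 1) * (m + 1)) ^ 2 := Nat.pow_le_pow_left hMm.le 2
      _ = (m + 1) ^ 4 := by ring
      _ ≤ (2 ^ (2 * l ^ 2 * (J + 1))) ^ 4 := Nat.pow_le_pow_left hJ2 4
      _ = _ := by rw [← pow_mul]; congr 1; ring
  set F : ({v // v ∈ X ∪ Y} × Fin (J + 1) → Finset V) → Finset ({e // e ∈ G} → V) := fun P =>
    ((Fintype.piFinset fun _ : {e // e ∈ G} => Finset.range (J + 2)).filter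
      fun f => ∑ e, f e ≤ 2 * (C * M ^ 2)).biUnion
        fun f => Fintype.piFinset fun e => levelColors (X ∪ Y) Z J P e (f e) with hF
  have hsub : EdgeColoring.color '' 𝒩
      ⊆ (((palettes (X ∪ Y) Z (l ^ 2) J).biUnion F : Finset _) : Set ({e // e ∈ G} → V)) := by
    rintro _ ⟨N, ⟨hNZ, hNfree⟩, rfl⟩
    -- The value `x₀` off `G` is a dummy and is never used.
    let col : Finset V → V := fun e => if h : e ∈ G then N.color ⟨e, h⟩ else x₀
    have hcol : ∀ e : {e // e ∈ G}, col e = N.color e := fun e => dif_pos e.2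
    have hext : N.extension = G.image fun e => insert (col e) e := by
      rw [EdgeColoring.extension]
      ext a
      simp only [Finset.mem_image, Finset.mem_attach, true_and]
      constructor
      · rintro ⟨e, rfl⟩
        exact ⟨e, e.2, by rw [hcol]⟩
      · rintro ⟨e, he, rfl⟩
        exact ⟨⟨e, he⟩, by rw [← hcol]⟩
    rw [hext] at hNfree
    obtain ⟨P, hP, f, hf1, hf2, hf3⟩ := exists_palette_level hl X Y hXY hMpos col
      (fun e he => by rw [hcol ⟨e, he⟩]; exact N.color_notMem ⟨e, he⟩) hNfree Z
      (fun e he => by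
        rw [hcol ⟨e, he⟩, ← hNZ]
        exact Finset.mem_image_of_mem _ (Finset.mem_attach _ _)) J hJM
    refine Finset.mem_coe.2 (Finset.mem_biUnion.2 ⟨P, hP, Finset.mem_biUnion.2 ⟨f, ?_, ?_⟩⟩)
    · exact Finset.mem_filter.2
        ⟨Fintype.mem_piFinset.2 fun e => Finset.mem_range.2 (hf1 e), hf2⟩
    · exact Fintype.mem_piFinset.2 fun e => hcol e ▸ hf3 e
  have hcard2 : ∀ e ∈ G, e.card ≤ 2 := by
    intro e he
    obtain ⟨x, -, y, -, rfl⟩ := mem_completeBipartiteOn.1 he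
    exact Finset.card_le_two
  have hFcard : ∀ P ∈ palettes (X ∪ Y) Z (l ^ 2) J,
      (F P).card ≤ 2 ^ (2 * G.card + (8 * l ^ 2 + 1) * (2 * (C * M ^ 2))) := by
    intro P hP
    have h := card_biUnion_piFinset_le (fun e : {e // e ∈ G} => levelColors (X ∪ Y) Z J P e)
      (8 * l ^ 2) (J + 2) (2 * (C * M ^ 2)) fun e j _ =>
        card_levelColors_le (X ∪ Y) Z J (l ^ 2) (8 * l ^ 2) P
          (fun a => (Finset.mem_filter.1 (Fintype.mem_piFinset.1 hP a)).2)
          (Nat.le_mul_of_pos_left _ (by norm_num)) hZJ e (hcard2 e e.2) j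
    rwa [Fintype.card_coe] at h
  have hinj : Function.Injective (EdgeColoring.color (G := G)) := fun _ _ h => EdgeColoring.ext h
  calc 𝒩.ncard = (EdgeColoring.color '' 𝒩).ncard := (Set.ncard_image_of_injective _ hinj).symm
    _ ≤ ((palettes (X ∪ Y) Z (l ^ 2) J).biUnion F).card := by
        rw [← Set.ncard_coe_finset]
        exact Set.ncard_le_ncard hsub (Finset.finite_toSet _)
    _ ≤ (palettes (X ∪ Y) Z (l ^ 2) J).card
          * 2 ^ (2 * G.card + (8 * l ^ 2 + 1) * (2 * (C * M ^ 2))) :=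
        Finset.card_biUnion_le_card_mul _ _ _ hFcard
    -- The 6 in the final exponent is 4 from the palettes plus 2 from the edge count `|G| ≤ M²`.
    _ ≤ 2 ^ (4 * M ^ 2) * 2 ^ (2 * M ^ 2 + (8 * l ^ 2 + 1) * (2 * (C * M ^ 2))) :=
        Nat.mul_le_mul
          (card_palettes_le_two_pow _ Z _ J m M hJ1 hmM hMm (Finset.card_union_le _ _) hZM)
          (Nat.pow_le_pow_right (by norm_num)
            (Nat.add_le_add_right (Nat.mul_le_mul_left _ hGM) _))
    _ = _ := by rw [← pow_add]; congr 1; ring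

theorem mainTheorem3 (l : ℕ) (hl : 2 ≤ l) :
    ∃ D : ℝ, 0 < D ∧
      ∀ (n s t : ℕ), 1 ≤ s → 1 ≤ t →
      ∀ (X Y : Finset (Fin n)), Disjoint X Y → X.card = s → Y.card = t →
      ∀ Z : Finset (Fin n),
        (({N : EdgeColoring (completeBipartiteOn X Y) |
            N.colorSet = Z ∧ ¬ ContainsLooseCycle N.extension (2 * l)}.ncard : ℕ) : ℝ)
          ≤ D ^ ((s + t) ^ 2) := by
  refine ⟨2 ^ (6 + (8 * l ^ 2 + 1) * (2 * (4 * l ^ 2 + l ^ 4 + 2 * l ^ 3))), by positivity, ?_⟩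
  rintro n _ _ hs ht X Y hXY rfl rfl Z
  rw [← pow_mul]
  exact_mod_cast ncard_edgeColoring_le hl X Y hXY (Finset.card_pos.1 hs) Z
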